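/- Let $d\ge 1$, let $\mathcal X\subset\mathbb R^d$ be compact, and let $x,x'\in\mathcal X$ be query points at which $\mathcal X$ is regular, i.e. for $z\in\{x,x'\}$ there is $c>0$ with $\mathrm{vol}(\mathcal X\cap \bar B(z,\rho))\ge c\rho^d$ for all $0<\rho\le 1$ (true e.g. if $z$ is an interior point of $\mathcal X$, or if $\mathcal X$ is a cube). Given covariates $X_1,\dots,X_n\in\mathcal X$, $n\ge 2$, the real outcomes $Y_{i_1i_2}=Y_{i_2i_1}$, $i_1<i_2$, are independent with $Y_{i_1i_2}\sim Q(\cdot\mid X_{i_1},X_{i_2})$, where $Q(\cdot\mid z,z')$ has mean $f(z,z')$ and variance less than a constant $\tau>0$ for all $z,z'\in\mathcal X$. For $0<\beta\le 1$ and $L>0$ let $\mathcal F(\beta,L)$ be the set of symmetric $f:\mathcal X^2\to\mathbb R$ with $|f(z,z')-f(\tilde z,z')|\le L\|z-\tilde z\|^\beta$ and $|f(z,z')|\le L$ for all $z,\tilde z,z'\in\mathcal X$. Let $K:\mathbb R^d\to[0,\infty)$ be a bounded, compactly supported probability density with $K(-z)=K(z)$ (so with mean zero and finite second moment), such that $\underline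 k\,\sup_z K(z)\le\inf_{\|z\|\le r}K(z)$ for some $\underline k,r>0$. Put $K_h(z)=h^{-d}K(z/h)$, $I_n=\{(i_1,i_2):1\le i_1\ne i_2\le n\}$ and $$\hat f_{n,h}(x,x')=\frac{|I_n|^{-1}\sum_{(i_1,i_2)\in I_n}Y_{i_1i_2}\{K_h(x-X_{i_1})K_h(x'-X_{i_2})+\lambda_n\}}{|I_n|^{-1}\sum_{(i_1,i_2)\in I_n}\{K_h(x-X_{i_1})K_h(x'-X_{i_2})+\lambda_n\}}.$$ Fix $\nu>0$. Then there is a constant $C>0$, not depending on $n$, $h$ or $\lambda_n$, such that whenever $n\ge2$, $n^{-1/d}\le h\le 1$ and $(nh^d)^{-\nu}\le\lambda_n\le h^d$, the following bounds hold, the suprema being also over all conditional distributions $Q$ with mean $f$ and variance less than $\tau$. (a) Fixed design: if $X_1,\dots,X_n\in\mathcal X$ are deterministic with $\|X_i-X_j\|\ge c_X n^{-1/d}$ for $i\ne j$ and $\sup_{z\in\mathcal X}\min_j\|z-X_j\|\le C_Xn^{-1/d}$, where $c_X,C_X>0$ do not depend on $n$, then $$\sup_{f\in\mathcal F(\beta,L)}\mathbb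 E|f(x,x')-\hat f_{n,h}(x,x')|^2\le C\{h^{2\beta}+(nh^d)^{-2}\}.$$ (b) Random design: if $X_1,\dots,X_n$ are i.i.d. with a density $m$ on $\mathcal X$ that is continuous and satisfies $0<l\le m\le u<\infty$ on $\mathcal X$, then $$\sup_{f\in\mathcal F(\beta,L)}\mathbb E|f(x,x')-\hat f_{n,h}(x,x')|^2\le C\{h^{2\beta}+h^{2\beta}(nh^d)^{-1}+(nh^d)^{-2}\}.$$ -/

import Mathlib

open MeasureTheory ProbabilityTheory

noncomputable section

namespace LinkRegression

/-- `ℝ^d` with the Euclidean norm. -/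
abbrev E (d : ℕ) : Type := EuclideanSpace ℝ (Fin d)

/-- The unordered pairs of distinct nodes, represented by `(i₁, i₂)` with `i₁ < i₂`. -/
abbrev Link (n : ℕ) : Type := {p : Fin n × Fin n // p.1 < p.2}

/-- The query point `x` is not at a cusp of the covariate domain `𝒳`: balls of radius `ρ ≤ 1`
around `x` meet `𝒳` in a set of volume of order `ρ ^ d`. It holds at every interior point of `𝒳`
and at every point of a cube, a convex body or a Lipschitz domain. -/
def VolumeRegularAt {d : ℕ} (𝒳 : Set (E d)) (x : E d) : Prop :=
  ∃ c : ℝ, 0 < c ∧ ∀ ρ : ℝ, 0 < ρ → ρ ≤ 1 →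
    ENNReal.ofReal (c * ρ ^ d) ≤ volume (𝒳 ∩ Metric.closedBall x ρ)

/-- The class `𝓕(β, L)` of link regression functions: symmetric functions on `𝒳 × 𝒳`, bounded by
`L` and Hölder continuous in the first (hence in either) argument. Values outside of `𝒳 × 𝒳`
play no role. -/
def HolderClass {d : ℕ} (𝒳 : Set (E d)) (β L : ℝ) : Set (E d → E d → ℝ) :=
  {f | (∀ x ∈ 𝒳, ∀ x' ∈ 𝒳, f x x' = f x' x) ∧
    (∀ x ∈ 𝒳, ∀ y ∈ 𝒳, ∀ x' ∈ 𝒳, |f x x' - f y x'| ≤ L * ‖x - y‖ ^ β) ∧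
    (∀ x ∈ 𝒳, ∀ x' ∈ 𝒳, |f x x'| ≤ L)}

/-- `Q (x, x')`, the conditional distribution of the outcome given the covariates `x, x'` of the
two nodes, has mean `f x x'` and variance `σ²(x, x') < τ`, for all `x, x' ∈ 𝒳`. -/
structure IsOutcomeModel {d : ℕ} (𝒳 : Set (E d)) (τ : ℝ) (f : E d → E d → ℝ)
    (Q : Kernel (E d × E d) ℝ) : Prop where
  memLp : ∀ x ∈ 𝒳, ∀ x' ∈ 𝒳, MemLp (fun y : ℝ => y) 2 (Q (x, x'))
  mean : ∀ x ∈ 𝒳, ∀ x' ∈ 𝒳, ∫ y, y ∂(Q (x, x')) = f x x'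
  variance_lt : ∀ x ∈ 𝒳, ∀ x' ∈ 𝒳, variance (fun y : ℝ => y) (Q (x, x')) < τ

/-- The conditions on the `d`-variate kernel. -/
structure IsSmoothingKernel {d : ℕ} (K : E d → ℝ) : Prop where
  measurable : Measurable K
  nonneg : ∀ z, 0 ≤ K z
  integral_eq_one : ∫ z, K z = 1
  compactSupport : HasCompactSupport K
  symmetric : ∀ z, K (-z) = K z
  bounded : BddAbove (Set.range K)
  mean_zero : ∫ z, K z • z = 0
  secondMoment : Integrable (fun z => ‖z‖ ^ 2 * K z)
  lower : ∃ k r : ℝ, 0 < k ∧ 0 < r ∧ ∀ z, ‖z‖ ≤ r → k * (⨆ w, K w) ≤ K z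

/-- Nearly equispaced deterministic covariates in `𝒳`: they are separated at the scale
`n ^ (-1 / d)`, and every point of `𝒳` has a covariate within that scale. -/
structure IsFixedDesign {d : ℕ} (𝒳 : Set (E d)) (c_X C_X : ℝ) {n : ℕ} (X : Fin n → E d) :
    Prop where
  mem : ∀ i, X i ∈ 𝒳
  separated : ∀ i j, i ≠ j → c_X / (n : ℝ) ^ ((1 : ℝ) / d) ≤ ‖X i - X j‖
  covering : ∀ z ∈ 𝒳, ∃ j, ‖z - X j‖ ≤ C_X / (n : ℝ) ^ ((1 : ℝ) / d)

/-- The law on `𝒳` with Lebesgue density `m`. -/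
def covariateLaw {d : ℕ} (𝒳 : Set (E d)) (m : E d → ℝ) : Measure (E d) :=
  (volume.restrict 𝒳).withDensity fun z => ENNReal.ofReal (m z)

/-- `m` is a probability density on `𝒳`, continuous and bounded above and away from zero. -/
structure IsDesignDensity {d : ℕ} (𝒳 : Set (E d)) (m : E d → ℝ) : Prop where
  continuousOn : ContinuousOn m 𝒳
  bounds : ∃ l u : ℝ, 0 < l ∧ ∀ z ∈ 𝒳, l ≤ m z ∧ m z ≤ u
  isProbability : IsProbabilityMeasure (covariateLaw 𝒳 m)

/-- The bandwidth `h` and the regularization parameter `lam` are admissible for sample size `n`. -/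
structure IsAdmissible (d n : ℕ) (ν h lam : ℝ) : Prop where
  le_h : (n : ℝ) ^ (-(1 : ℝ) / d) ≤ h
  h_le : h ≤ 1
  le_lam : 1 / ((n : ℝ) * h ^ d) ^ ν ≤ lam
  lam_le : lam ≤ h ^ d

/-- The law of the outcomes `(Y_{i₁,i₂})_{i₁ < i₂}` given the covariates `X`: they are independent
and `Y_{i₁,i₂}` has law `Q (X i₁, X i₂)`. -/
def outcomeKernel {d : ℕ} (Q : Kernel (E d × E d) ℝ) [IsMarkovKernel Q] (n : ℕ) :
    Kernel (Fin n → E d) (Link n → ℝ) where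
  toFun X := Measure.pi fun p : Link n => Q (X p.1.1, X p.1.2)
  measurable' := by
    refine Measurable.measure_of_isPiSystem_of_isProbabilityMeasure
      (generateFrom_pi (α := fun _ : Link n => ℝ)).symm
      (isPiSystem_pi (α := fun _ : Link n => ℝ)) ?_
    rintro s ⟨t, ht, rfl⟩
    simp only [Measure.pi_pi]
    refine Finset.measurable_prod _ fun p _ => ?_
    have hp : Measurable fun X : Fin n → E d => (X p.1.1, X p.1.2) := by fun_prop
    exact (Q.measurable_coe (ht p (Set.mem_univ p))).comp hp

instance {d : ℕ} (Q : Kernel (E d × E d) ℝ) [IsMarkovKernel Q] (n : ℕ) :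
    IsMarkovKernel (outcomeKernel Q n) :=
  ⟨fun X => by
    change IsProbabilityMeasure (Measure.pi fun p : Link n => Q (X p.1.1, X p.1.2))
    infer_instance⟩

/-- The symmetric array of outcomes `Y_{i₁,i₂} = Y_{i₂,i₁}`; the diagonal is never used. -/
def symOutcome {n : ℕ} (Y : Link n → ℝ) (i j : Fin n) : ℝ :=
  if hij : i < j then Y ⟨(i, j), hij⟩ else if hji : j < i then Y ⟨(j, i), hji⟩ else 0

/-- `K_h(z) = h^{-d} K(z / h)`. -/
def scaledKernel {d : ℕ} (K : E d → ℝ) (h : ℝ) (z : E d) : ℝ :=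
  (h ^ d)⁻¹ * K (h⁻¹ • z)

/-- The index set `I_n` of ordered pairs of distinct nodes. -/
def pairs (n : ℕ) : Finset (Fin n × Fin n) := Finset.univ.offDiag

/-- The kernel smoother `f̂_{n,h}(x, x')`. -/
def smoother {d n : ℕ} (K : E d → ℝ) (h lam : ℝ) (x x' : E d)
    (X : Fin n → E d) (Y : Link n → ℝ) : ℝ :=
  (((pairs n).card : ℝ)⁻¹ * ∑ p ∈ pairs n, symOutcome Y p.1 p.2 *
      (scaledKernel K h (x - X p.1) * scaledKernel K h (x' - X p.2) + lam)) /
    (((pairs n).card : ℝ)⁻¹ * ∑ p ∈ pairs n,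
      (scaledKernel K h (x - X p.1) * scaledKernel K h (x' - X p.2) + lam))

/-- The mean squared error `𝔼|f(x,x') - f̂_{n,h}(x,x')|²` for deterministic covariates `X`. -/
def fixedRisk {d n : ℕ} (K : E d → ℝ) (h lam : ℝ) (x x' : E d) (f : E d → E d → ℝ)
    (Q : Kernel (E d × E d) ℝ) [IsMarkovKernel Q] (X : Fin n → E d) : ENNReal :=
  ∫⁻ Y, ENNReal.ofReal (|f x x' - smoother K h lam x x' X Y| ^ 2) ∂(outcomeKernel Q n X)

/-- The mean squared error `𝔼|f(x,x') - f̂_{n,h}(x,x')|²` for i.i.d. covariates with law `μ`; the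
expectation is with respect to the joint law of covariates and outcomes. -/
def randomRisk {d : ℕ} (n : ℕ) (K : E d → ℝ) (h lam : ℝ) (x x' : E d) (f : E d → E d → ℝ)
    (Q : Kernel (E d × E d) ℝ) [IsMarkovKernel Q] (μ : Measure (E d)) : ENNReal :=
  ∫⁻ XY, ENNReal.ofReal (|f x x' - smoother K h lam x x' XY.1 XY.2| ^ 2)
    ∂((Measure.pi fun _ : Fin n => μ) ⊗ₘ outcomeKernel Q n)

/-- The worst-case mean squared error in fixed design, over all `f` in `𝓕(β, L)` and all
conditional outcome distributions with mean `f` and variance below `τ`. -/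
def worstFixedRisk {d n : ℕ} (𝒳 : Set (E d)) (β L τ : ℝ) (K : E d → ℝ) (h lam : ℝ)
    (x x' : E d) (X : Fin n → E d) : ENNReal :=
  ⨆ (f : E d → E d → ℝ) (_ : f ∈ HolderClass 𝒳 β L) (Q : Kernel (E d × E d) ℝ)
    (_ : IsMarkovKernel Q) (_ : IsOutcomeModel 𝒳 τ f Q), fixedRisk K h lam x x' f Q X

/-- The worst-case mean squared error in random design. -/
def worstRandomRisk {d : ℕ} (𝒳 : Set (E d)) (β L τ : ℝ) (n : ℕ) (K : E d → ℝ) (h lam : ℝ)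
    (x x' : E d) (m : E d → ℝ) : ENNReal :=
  ⨆ (f : E d → E d → ℝ) (_ : f ∈ HolderClass 𝒳 β L) (Q : Kernel (E d × E d) ℝ)
    (_ : IsMarkovKernel Q) (_ : IsOutcomeModel 𝒳 τ f Q),
      randomRisk n K h lam x x' f Q (covariateLaw 𝒳 m)

end LinkRegression

end

/-! Given the covariates, the smoother is a linear form in independent outcomes, so its risk is
squared bias plus variance (`lintegral_sq_sub_sum_pi`, `fixedRisk_le_bias_add_variance`). Suppose at
least `c * (n * h ^ d)` covariates lie within `r * h` of each query point. Then the average kernel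
product is bounded below (`le_sum_scaledKernel_mul`). Pairs with nonzero kernel product lie within
`R * h`, so they contribute bias of order `h ^ β`; the regularization contributes `lam ≤ h ^ d ≤ h ^
β`. The variance is at most a multiple of the largest weight over the total weight, of order `(n * h
^ d)⁻²` (`exists_fixedRisk_le_of_near`).

It remains to count covariates. In fixed design, a volume comparison gives the count unless `n * h ^
d` is bounded. In random design, the count is binomial and falls short with exponentially small
probability. In both exceptional cases the risk is still at most a constant (`fixedRisk_le_const`),
which the term `(n * h ^ d)⁻²` absorbs. Since the bias bound holds for each good realization of the
covariates, the mixed term in (b) is not needed. -/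

namespace LinkRegression

/-! ### Bias and variance given the covariates -/

/-- Bias-variance decomposition of a linear form in independent real variables. -/
lemma lintegral_sq_sub_sum_pi {ι : Type*} [Fintype ι] (ν : ι → Measure ℝ)
    [∀ i, IsProbabilityMeasure (ν i)] (hν : ∀ i, MemLp (fun y : ℝ => y) 2 (ν i)) (t : ℝ)
    (c : ι → ℝ) :
    ∫⁻ y, ENNReal.ofReal ((t - ∑ i, c i * y i) ^ 2) ∂(Measure.pi ν) =
      ENNReal.ofReal ((t - ∑ i, c i * ∫ y, y ∂(ν i)) ^ 2 +
        ∑ i, c i ^ 2 * variance (fun y : ℝ => y) (ν i)) := by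
  have hi (i : ι) : MemLp (fun y : ι → ℝ => c i * y i) 2 (Measure.pi ν) :=
    ((hν i).comp_measurePreserving (measurePreserving_eval ν i)).const_mul (c i)
  have hZ : MemLp (fun y : ι → ℝ => ∑ i, c i * y i) 2 (Measure.pi ν) :=
    memLp_finsetSum _ fun i _ => hi i
  have hG : MemLp (fun y : ι → ℝ => t - ∑ i, c i * y i) 2 (Measure.pi ν) :=
    (memLp_const t).sub hZ
  have hmean : ∫ y, (t - ∑ i, c i * y i) ∂(Measure.pi ν) = t - ∑ i, c i * ∫ y, y ∂(ν i) := by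
    rw [integral_sub (integrable_const t) (hZ.integrable (by norm_num)),
      integral_finsetSum _ fun i _ => (hi i).integrable (by norm_num)]
    simp only [integral_const, probReal_univ, smul_eq_mul, one_mul, integral_const_mul]
    congr 1
    refine Finset.sum_congr rfl fun i _ => ?_
    rw [integral_comp_eval (μ := ν) (f := fun y : ℝ => y) aestronglyMeasurable_id]
  have hvar : variance (fun y : ι → ℝ => t - ∑ i, c i * y i) (Measure.pi ν) =
      ∑ i, c i ^ 2 * variance (fun y : ℝ => y) (ν i) := by
    rw [variance_const_sub hZ.aestronglyMeasurable]
    have := variance_sum_pi (μ := ν) (X := fun i y => c i * y) fun i => (hν i).const_mul (c i)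
    rw [Finset.sum_congr rfl fun i _ => (variance_const_mul (c i) (fun y : ℝ => y) (ν i)).symm,
      ← this]
    congr 1
    ext y
    simp
  rw [← ofReal_integral_eq_lintegral_ofReal hG.integrable_sq (ae_of_all _ fun _ => sq_nonneg _)]
  congr 1
  have := variance_eq_sub hG
  rw [hvar, hmean] at this
  simp only [Pi.pow_apply] at this
  linarith

/-- Independence holds over unordered links only, so the two orientations of a pair must be merged
before variances are added. -/
lemma sum_pairs_eq_sum_link {n : ℕ} (g : Fin n → Fin n → ℝ) :
    ∑ p ∈ pairs n, g p.1 p.2 = ∑ q : Link n, (g q.1.1 q.1.2 + g q.1.2 q.1.1) := by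
  have hlt : ∑ p ∈ pairs n with p.1 < p.2, g p.1 p.2 = ∑ q : Link n, g q.1.1 q.1.2 := by
    refine Finset.sum_subtype _ (fun p => ?_) (fun p : Fin n × Fin n => g p.1 p.2)
    simp only [pairs, Finset.mem_filter, Finset.mem_offDiag, Finset.mem_univ, true_and]
    exact ⟨fun h => h.2, fun h => ⟨h.ne, h⟩⟩
  have hgt : ∑ p ∈ pairs n with ¬ p.1 < p.2, g p.1 p.2 = ∑ q : Link n, g q.1.2 q.1.1 := by
    rw [← Finset.sum_subtype (p := fun p : Fin n × Fin n => p.1 < p.2)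
      ((pairs n).filter fun p => p.1 < p.2) (fun p => by
        simp only [pairs, Finset.mem_filter, Finset.mem_offDiag, Finset.mem_univ, true_and]
        exact ⟨fun h => h.2, fun h => ⟨h.ne, h⟩⟩) (fun p => g p.2 p.1)]
    refine Finset.sum_nbij' Prod.swap Prod.swap ?_ ?_ ?_ ?_ ?_
    all_goals rintro ⟨i, j⟩ hij
    all_goals simp only [pairs, Finset.mem_filter, Finset.mem_offDiag, Finset.mem_univ, true_and,
      Prod.swap_prod_mk] at hij ⊢
    · exact ⟨Ne.symm hij.1, lt_of_le_of_ne (not_lt.1 hij.2) (Ne.symm hij.1)⟩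
    · exact ⟨Ne.symm hij.1, not_lt.2 hij.2.le⟩
  rw [← Finset.sum_filter_add_sum_filter_not (pairs n) (fun p => p.1 < p.2), hlt, hgt,
    Finset.sum_add_distrib]

lemma sum_pairs_symOutcome_mul {n : ℕ} (Y : Link n → ℝ) (w : Fin n → Fin n → ℝ) :
    ∑ p ∈ pairs n, symOutcome Y p.1 p.2 * w p.1 p.2 =
      ∑ q : Link n, (w q.1.1 q.1.2 + w q.1.2 q.1.1) * Y q := by
  rw [sum_pairs_eq_sum_link fun i j => symOutcome Y i j * w i j]
  refine Finset.sum_congr rfl fun q _ => ?_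
  have h1 := q.2
  have h2 : ¬ q.1.2 < q.1.1 := not_lt.2 h1.le
  simp only [symOutcome, h1, h2, dif_pos, dif_neg, not_false_eq_true]
  ring

/-- The weight of the outcome `Y i j` in the smoother. -/
noncomputable def linkWeight {d n : ℕ} (K : E d → ℝ) (h lam : ℝ) (x x' : E d) (X : Fin n → E d)
    (i j : Fin n) : ℝ :=
  scaledKernel K h (x - X i) * scaledKernel K h (x' - X j) + lam

lemma card_pairs (n : ℕ) : ((pairs n).card : ℝ) = n * (n - 1) := by
  rw [pairs, Finset.offDiag_card, Nat.cast_sub (Nat.le_mul_self _)]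
  simp
  ring

lemma card_pairs_pos {n : ℕ} (hn : 2 ≤ n) : (0 : ℝ) < (pairs n).card := by
  have : (2 : ℝ) ≤ n := by exact_mod_cast hn
  rw [card_pairs]
  nlinarith

lemma smoother_eq_sum_link {d n : ℕ} (hn : 2 ≤ n) (K : E d → ℝ) (h lam : ℝ) (x x' : E d)
    (X : Fin n → E d) (Y : Link n → ℝ) :
    smoother K h lam x x' X Y = ∑ q : Link n,
      ((linkWeight K h lam x x' X q.1.1 q.1.2 + linkWeight K h lam x x' X q.1.2 q.1.1) /
        ∑ p ∈ pairs n, linkWeight K h lam x x' X p.1 p.2) * Y q := by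
  have := sum_pairs_symOutcome_mul Y (linkWeight K h lam x x' X)
  simp only [smoother, linkWeight] at this ⊢
  rw [mul_div_mul_left _ _ (inv_ne_zero (card_pairs_pos hn).ne'), this, Finset.sum_div]
  exact Finset.sum_congr rfl fun q _ => by ring

/-- The normalized weights sum to one, so `f x x'` can be moved inside the weighted average;
symmetry of `f` then splits each link back into its two orientations. The factor 2 comes from `(a +
b) ^ 2 ≤ 2 * (a ^ 2 + b ^ 2)`. -/
lemma fixedRisk_le_bias_add_variance {d n : ℕ} {𝒳 : Set (E d)} {τ h lam : ℝ} (hn : 2 ≤ n)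
    {K : E d → ℝ} {x x' : E d} {f : E d → E d → ℝ}
    (hsymm : ∀ x ∈ 𝒳, ∀ x' ∈ 𝒳, f x x' = f x' x)
    {Q : Kernel (E d × E d) ℝ} [IsMarkovKernel Q] (hQ : IsOutcomeModel 𝒳 τ f Q)
    {X : Fin n → E d} (hX : ∀ i, X i ∈ 𝒳) {D : ℝ} (hD : 0 < D)
    (hDw : ∑ p ∈ pairs n, linkWeight K h lam x x' X p.1 p.2 = D) :
    fixedRisk K h lam x x' f Q X ≤ ENNReal.ofReal
      (((∑ p ∈ pairs n, |f x x' - f (X p.1) (X p.2)| * |linkWeight K h lam x x' X p.1 p.2|) / D) ^ 2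
        + 2 * τ * (∑ p ∈ pairs n, linkWeight K h lam x x' X p.1 p.2 ^ 2) / D ^ 2) := by
  set w := linkWeight K h lam x x' X with hw
  have hrisk : fixedRisk K h lam x x' f Q X =
      ∫⁻ Y, ENNReal.ofReal ((f x x' - ∑ q : Link n, ((w q.1.1 q.1.2 + w q.1.2 q.1.1) / D) * Y q) ^ 2)
        ∂(Measure.pi fun p : Link n => Q (X p.1.1, X p.1.2)) := by
    simp only [fixedRisk, sq_abs, smoother_eq_sum_link hn, ← hw, hDw]
    rfl
  rw [hrisk, lintegral_sq_sub_sum_pi _ fun q : Link n => hQ.memLp _ (hX q.1.1) _ (hX q.1.2)]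
  have hτ : 0 ≤ τ := by
    have h0 : Fin n := ⟨0, by omega⟩
    exact (variance_nonneg _ _).trans (hQ.variance_lt _ (hX h0) _ (hX h0)).le
  refine ENNReal.ofReal_le_ofReal (add_le_add ?_ ?_)
  · have hmean : f x x' - ∑ q : Link n, ((w q.1.1 q.1.2 + w q.1.2 q.1.1) / D) *
        ∫ y, y ∂(Q (X q.1.1, X q.1.2)) =
        (∑ p ∈ pairs n, (f x x' - f (X p.1) (X p.2)) * w p.1 p.2) / D := by
      rw [sum_pairs_eq_sum_link fun i j => (f x x' - f (X i) (X j)) * w i j]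
      have hD' : f x x' = (∑ q : Link n, f x x' * (w q.1.1 q.1.2 + w q.1.2 q.1.1)) / D := by
        rw [← Finset.mul_sum, ← sum_pairs_eq_sum_link w, hDw]
        field_simp
      nth_rw 1 [hD']
      rw [Finset.sum_div, Finset.sum_div, ← Finset.sum_sub_distrib]
      refine Finset.sum_congr rfl fun q _ => ?_
      rw [hQ.mean _ (hX q.1.1) _ (hX q.1.2), hsymm _ (hX q.1.2) _ (hX q.1.1)]
      ring
    rw [hmean, ← sq_abs, abs_div, abs_of_pos hD]
    gcongr
    refine (Finset.abs_sum_le_sum_abs _ _).trans (le_of_eq ?_)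
    simp only [abs_mul]
  · rw [sum_pairs_eq_sum_link fun i j => w i j ^ 2, Finset.mul_sum, Finset.sum_div]
    refine Finset.sum_le_sum fun q _ => ?_
    rw [div_pow, div_mul_eq_mul_div]
    refine div_le_div_of_nonneg_right ?_ (sq_nonneg D)
    refine (mul_le_mul_of_nonneg_left (hQ.variance_lt _ (hX q.1.1) _ (hX q.1.2)).le
      (sq_nonneg _)).trans ?_
    nlinarith [mul_nonneg hτ (sq_nonneg (w q.1.1 q.1.2 - w q.1.2 q.1.1))]

/-! ### Pointwise bounds on the kernel and the regression function -/

/-- A kernel of integral one has positive supremum, which makes `κ` positive. The cap `r ≤ 1` keeps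
radii `r * h` in the range where volume regularity applies. -/
lemma IsSmoothingKernel.exists_bounds {d : ℕ} {K : E d → ℝ} (hK : IsSmoothingKernel K) :
    ∃ M R r κ : ℝ, 0 < R ∧ 0 < r ∧ r ≤ 1 ∧ 0 < κ ∧ (∀ z, K z ≤ M) ∧
      (∀ z, K z ≠ 0 → ‖z‖ ≤ R) ∧ ∀ z, ‖z‖ ≤ r → κ ≤ K z := by
  obtain ⟨k, r, hk, hr, hkr⟩ := hK.lower
  obtain ⟨R, hR⟩ := hK.compactSupport.isCompact.isBounded.subset_closedBall (0 : E d)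
  have hM : 0 < ⨆ w, K w := by
    by_contra hneg
    have h0 : K = fun _ => 0 := by
      ext z
      exact le_antisymm ((le_ciSup hK.bounded z).trans (not_lt.1 hneg)) (hK.nonneg z)
    have := hK.integral_eq_one
    simp [h0] at this
  refine ⟨⨆ w, K w, max R 1, min r 1, k * ⨆ w, K w, by positivity, by positivity,
    min_le_right _ _, by positivity, fun z => le_ciSup hK.bounded z, fun z hz => ?_,
    fun z hz => hkr z (hz.trans (min_le_left _ _))⟩
  have := hR (subset_tsupport K hz)
  rw [mem_closedBall_zero_iff] at this
  exact this.trans (le_max_left _ _)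

section ScaledKernel

variable {d : ℕ} {K : E d → ℝ} {h : ℝ}

lemma scaledKernel_nonneg (hK : ∀ z, 0 ≤ K z) (hh : 0 < h) (z : E d) :
    0 ≤ scaledKernel K h z :=
  mul_nonneg (by positivity) (hK _)

lemma scaledKernel_le {M : ℝ} (hM : ∀ z, K z ≤ M) (hh : 0 < h) (z : E d) :
    scaledKernel K h z ≤ (h ^ d)⁻¹ * M :=
  mul_le_mul_of_nonneg_left (hM _) (by positivity)

lemma norm_inv_smul_le_iff (hh : 0 < h) (z : E d) (ρ : ℝ) : ‖h⁻¹ • z‖ ≤ ρ ↔ ‖z‖ ≤ ρ * h := by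
  rw [norm_smul, Real.norm_of_nonneg (by positivity), inv_mul_le_iff₀ hh, mul_comm]

lemma norm_le_of_scaledKernel_ne_zero {R : ℝ} (hR : ∀ z, K z ≠ 0 → ‖z‖ ≤ R) (hh : 0 < h) {z : E d}
    (hz : scaledKernel K h z ≠ 0) : ‖z‖ ≤ R * h :=
  (norm_inv_smul_le_iff hh z R).1 (hR _ (right_ne_zero_of_mul hz))

lemma le_scaledKernel {r κ : ℝ} (hκ : ∀ z, ‖z‖ ≤ r → κ ≤ K z) (hh : 0 < h) {z : E d}
    (hz : ‖z‖ ≤ r * h) : (h ^ d)⁻¹ * κ ≤ scaledKernel K h z :=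
  mul_le_mul_of_nonneg_left (hκ _ ((norm_inv_smul_le_iff hh z r).2 hz)) (by positivity)

end ScaledKernel

section HolderClass

variable {d : ℕ} {𝒳 : Set (E d)} {β L : ℝ} {f : E d → E d → ℝ}

lemma abs_sub_le_of_mem_holderClass (hf : f ∈ HolderClass 𝒳 β L) {x x' y y' : E d} (hx : x ∈ 𝒳)
    (hx' : x' ∈ 𝒳) (hy : y ∈ 𝒳) (hy' : y' ∈ 𝒳) : |f x x' - f y y'| ≤ 2 * L := by
  have h1 := abs_le.1 (hf.2.2 x hx x' hx')
  have h2 := abs_le.1 (hf.2.2 y hy y' hy')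
  rw [abs_le]
  constructor <;> linarith [h1.1, h1.2, h2.1, h2.2]

lemma abs_sub_le_rpow_of_mem_holderClass (hβ : 0 ≤ β) (hL : 0 ≤ L) (hf : f ∈ HolderClass 𝒳 β L)
    {x x' y y' : E d} (hx : x ∈ 𝒳) (hx' : x' ∈ 𝒳) (hy : y ∈ 𝒳) (hy' : y' ∈ 𝒳) {ρ : ℝ}
    (hxy : ‖x - y‖ ≤ ρ) (hxy' : ‖x' - y'‖ ≤ ρ) : |f x x' - f y y'| ≤ 2 * L * ρ ^ β := by
  have h1 := hf.2.1 x hx y hy x' hx'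
  have h2 := hf.2.1 x' hx' y' hy' y hy
  rw [hf.1 x' hx' y hy, hf.1 y' hy' y hy] at h2
  have h3 := mul_le_mul_of_nonneg_left (Real.rpow_le_rpow (norm_nonneg _) hxy hβ) hL
  have h4 := mul_le_mul_of_nonneg_left (Real.rpow_le_rpow (norm_nonneg _) hxy' hβ) hL
  have h5 := abs_sub_le (f x x') (f y x') (f y y')
  linarith

end HolderClass

/-! ### Risk bounds given the covariates -/

/-- Fallback when too few covariates are near the query points: `lam > 0` makes all weights
positive, so the smoother is a weighted average, with bias at most `2 * L` and `∑ w ^ 2 ≤ (∑ w) ^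
2`. -/
lemma fixedRisk_le_const {d n : ℕ} {𝒳 : Set (E d)} {β L τ h lam : ℝ} (hn : 2 ≤ n) (hτ : 0 ≤ τ)
    (hh : 0 < h) (hlam : 0 < lam) {K : E d → ℝ} (hK : ∀ z, 0 ≤ K z) {x x' : E d} (hx : x ∈ 𝒳)
    (hx' : x' ∈ 𝒳) {f : E d → E d → ℝ} (hf : f ∈ HolderClass 𝒳 β L)
    {Q : Kernel (E d × E d) ℝ} [IsMarkovKernel Q] (hQ : IsOutcomeModel 𝒳 τ f Q)
    {X : Fin n → E d} (hX : ∀ i, X i ∈ 𝒳) :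
    fixedRisk K h lam x x' f Q X ≤ ENNReal.ofReal (4 * L ^ 2 + 2 * τ) := by
  have hw (i j : Fin n) : 0 < linkWeight K h lam x x' X i j :=
    add_pos_of_nonneg_of_pos
      (mul_nonneg (scaledKernel_nonneg hK hh _) (scaledKernel_nonneg hK hh _)) hlam
  have hne : (pairs n).Nonempty := Finset.card_pos.1 (by exact_mod_cast card_pairs_pos hn)
  have hD : 0 < ∑ p ∈ pairs n, linkWeight K h lam x x' X p.1 p.2 :=
    Finset.sum_pos (fun p _ => hw _ _) hne
  refine (fixedRisk_le_bias_add_variance hn hf.1 hQ hX hD rfl).trans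
    (ENNReal.ofReal_le_ofReal (add_le_add ?_ ?_))
  · rw [show 4 * L ^ 2 = (2 * L) ^ 2 by ring]
    refine pow_le_pow_left₀ (by positivity) ?_ 2
    rw [div_le_iff₀ hD, Finset.mul_sum]
    refine Finset.sum_le_sum fun p _ => ?_
    rw [abs_of_pos (hw _ _)]
    exact mul_le_mul_of_nonneg_right
      (abs_sub_le_of_mem_holderClass hf hx hx' (hX _) (hX _)) (hw _ _).le
  · rw [div_le_iff₀ (by positivity)]
    exact mul_le_mul_of_nonneg_left
      (Finset.sum_sq_le_sq_sum_of_nonneg fun p _ => (hw _ _).le) (by positivity)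

open Classical in
/-- The covariates within distance `ρ` of `x`. -/
noncomputable def near {d n : ℕ} (X : Fin n → E d) (x : E d) (ρ : ℝ) : Finset (Fin n) :=
  Finset.univ.filter fun i => ‖x - X i‖ ≤ ρ

lemma mem_near {d n : ℕ} {X : Fin n → E d} {x : E d} {ρ : ℝ} {i : Fin n} :
    i ∈ near X x ρ ↔ ‖x - X i‖ ≤ ρ := by
  simp [near]

/-- The diagonal part of `A ×ˢ B` injects into `A`. -/
lemma card_mul_sub_one_le_card_filter_ne {α : Type*} [DecidableEq α] (A B : Finset α) :
    (A.card : ℝ) * (B.card - 1) ≤ ((A ×ˢ B).filter fun p => p.1 ≠ p.2).card := by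
  have h1 := Finset.card_filter_add_card_filter_not (s := A ×ˢ B) (fun p => p.1 ≠ p.2)
  have h2 : ((A ×ˢ B).filter fun p => ¬ p.1 ≠ p.2).card ≤ A.card := by
    refine Finset.card_le_card_of_injOn Prod.fst (fun p hp => ?_) fun p hp q hq hpq => ?_
    · simp only [Finset.coe_filter, Finset.mem_product, Set.mem_ofPred_eq] at hp
      exact hp.1.1
    · simp only [Finset.coe_filter, Finset.mem_product, Set.mem_ofPred_eq, not_not] at hp hq
      exact Prod.ext hpq (hp.2 ▸ hq.2 ▸ hpq)
  rw [Finset.card_product] at h1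
  have h3 : (A.card : ℝ) * B.card ≤ ((A ×ˢ B).filter fun p => p.1 ≠ p.2).card + A.card := by
    rw [← Nat.cast_mul, ← h1, Nat.cast_add]
    gcongr
  linarith

/-- A lower bound on the denominator of the smoother, without its regularization. -/
lemma le_sum_scaledKernel_mul {d n : ℕ} {K : E d → ℝ} (hK : ∀ z, 0 ≤ K z) {r κ h c : ℝ}
    (hκ : 0 < κ) (hr : ∀ z, ‖z‖ ≤ r → κ ≤ K z) (hh : 0 < h) (hc : 0 < c) {x x' : E d}
    {X : Fin n → E d} (hA : c * (n * h ^ d) ≤ (near X x (r * h)).card)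
    (hB : c * (n * h ^ d) ≤ (near X x' (r * h)).card) (hT : 2 ≤ c * (n * h ^ d)) :
    (pairs n).card * (κ ^ 2 * c ^ 2 / 2) ≤
      ∑ p ∈ pairs n, scaledKernel K h (x - X p.1) * scaledKernel K h (x' - X p.2) := by
  set A := near X x (r * h)
  set B := near X x' (r * h)
  have hsub : ((A ×ˢ B).filter fun p => p.1 ≠ p.2) ⊆ pairs n := fun p hp => by
    simp only [Finset.mem_filter] at hp
    simp [pairs, hp.2]
  have h1 : ((A ×ˢ B).filter fun p => p.1 ≠ p.2).card * (((h ^ d)⁻¹ * κ) * ((h ^ d)⁻¹ * κ)) ≤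
      ∑ p ∈ pairs n, scaledKernel K h (x - X p.1) * scaledKernel K h (x' - X p.2) := by
    refine le_trans ?_ (Finset.sum_le_sum_of_subset_of_nonneg hsub fun p _ _ =>
      mul_nonneg (scaledKernel_nonneg hK hh _) (scaledKernel_nonneg hK hh _))
    rw [← nsmul_eq_mul]
    refine Finset.card_nsmul_le_sum _ _ _ fun p hp => ?_
    simp only [Finset.mem_filter, Finset.mem_product] at hp
    have ha := le_scaledKernel hr hh (mem_near.1 hp.1.1)
    have hb := le_scaledKernel hr hh (mem_near.1 hp.1.2)
    exact mul_le_mul ha hb (by positivity) (scaledKernel_nonneg hK hh _)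
  refine le_trans ?_ h1
  have h2 := card_mul_sub_one_le_card_filter_ne A B
  -- Since `B` has at least two elements, removing the diagonal costs at most half of the pairs.
  have h3 : (c * (n * h ^ d)) ^ 2 / 2 ≤ ((A ×ˢ B).filter fun p => p.1 ≠ p.2).card := by
    refine le_trans ?_ h2
    nlinarith [mul_le_mul hA hB (by positivity) (by positivity)]
  calc (pairs n).card * (κ ^ 2 * c ^ 2 / 2) ≤ n ^ 2 * (κ ^ 2 * c ^ 2 / 2) := by
        gcongr
        rw [card_pairs]
        nlinarith [Nat.cast_nonneg (α := ℝ) n]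
    _ = (c * (n * h ^ d)) ^ 2 / 2 * (((h ^ d)⁻¹ * κ) * ((h ^ d)⁻¹ * κ)) := by
        field_simp
    _ ≤ _ := by gcongr

lemma const_le_div_sq {a T₀ T : ℝ} (ha : 0 ≤ a) (hT : 0 < T) (h : T ≤ T₀) :
    a ≤ a * T₀ ^ 2 * (1 / T ^ 2) := by
  rw [mul_one_div, le_div_iff₀ (by positivity)]
  gcongr

lemma linkWeight_le {d n : ℕ} {K : E d → ℝ} (hK : ∀ z, 0 ≤ K z) {M h lam : ℝ}
    (hM : ∀ z, K z ≤ M) (hh : 0 < h) (hh1 : h ≤ 1) (hlam : lam ≤ h ^ d) (x x' : E d)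
    (X : Fin n → E d) (i j : Fin n) :
    linkWeight K h lam x x' X i j ≤ (M ^ 2 + 1) / (h ^ d) ^ 2 := by
  have hM0 : 0 ≤ M := (hK 0).trans (hM 0)
  have hhd : h ^ d ≤ 1 := pow_le_one₀ hh.le hh1
  have h1 : scaledKernel K h (x - X i) * scaledKernel K h (x' - X j) ≤
      ((h ^ d)⁻¹ * M) * ((h ^ d)⁻¹ * M) :=
    mul_le_mul (scaledKernel_le hM hh _) (scaledKernel_le hM hh _)
      (scaledKernel_nonneg hK hh _) (by positivity)
  have h2 : lam ≤ 1 / (h ^ d) ^ 2 := by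
    refine (hlam.trans hhd).trans ?_
    rw [le_div_iff₀ (by positivity), one_mul]
    exact pow_le_one₀ (by positivity) hhd
  rw [linkWeight, add_div]
  refine add_le_add (h1.trans (le_of_eq ?_)) h2
  field_simp

/-- Since `∑ w ^ 2 ≤ W * ∑ w`, one factor of the squared total cancels. -/
lemma sum_sq_div_sq_sum_le {ι : Type*} {s : Finset ι} {w : ι → ℝ} {W D b : ℝ}
    (hw : ∀ i, 0 ≤ w i) (hW : ∀ i, w i ≤ W) (hD : ∑ i ∈ s, w i = D) (hb : 0 < b) (hbD : b ≤ D)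
    (hW0 : 0 ≤ W) : (∑ i ∈ s, w i ^ 2) / D ^ 2 ≤ W / b := by
  have hD0 : 0 < D := hb.trans_le hbD
  have h : ∑ i ∈ s, w i ^ 2 ≤ W * D := by
    rw [← hD, Finset.mul_sum]
    refine Finset.sum_le_sum fun i _ => ?_
    rw [sq]
    exact mul_le_mul_of_nonneg_right (hW i) (hw i)
  calc (∑ i ∈ s, w i ^ 2) / D ^ 2 ≤ W * D / D ^ 2 := by gcongr
    _ = W / D := by field_simp
    _ ≤ W / b := by gcongr

lemma mul_add_mul_le_add_mul_add {a b c u v : ℝ} (ha : 0 ≤ a) (hb : 0 ≤ b) (hc : 0 ≤ c)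
    (hu : 0 ≤ u) (hv : 0 ≤ v) : a * u + b * v ≤ (a + b + c) * (u + v) := by
  have h1 : a * u ≤ (a + b + c) * u := mul_le_mul_of_nonneg_right (by linarith) hu
  have h2 : b * v ≤ (a + b + c) * v := mul_le_mul_of_nonneg_right (by linarith) hv
  linarith

/-- The risk given the covariates, when sufficiently many covariates are near both query points. -/
lemma exists_fixedRisk_le_of_near {d : ℕ} (hd : 1 ≤ d) {𝒳 : Set (E d)} {x x' : E d} (hx : x ∈ 𝒳)
    (hx' : x' ∈ 𝒳) {β L τ : ℝ} (hβ : 0 ≤ β) (hβ1 : β ≤ 1) (hL : 0 ≤ L) (hτ : 0 ≤ τ)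
    {K : E d → ℝ} (hK : ∀ z, 0 ≤ K z) {M R r κ c : ℝ} (hR0 : 0 < R)
    (hκ : 0 < κ) (hM : ∀ z, K z ≤ M) (hR : ∀ z, K z ≠ 0 → ‖z‖ ≤ R)
    (hr : ∀ z, ‖z‖ ≤ r → κ ≤ K z) (hc : 0 < c) :
    ∃ C : ℝ, 0 ≤ C ∧ ∀ (n : ℕ) (h lam : ℝ), 2 ≤ n → 0 < h → h ≤ 1 → 0 < lam → lam ≤ h ^ d →
      ∀ f ∈ HolderClass 𝒳 β L, ∀ (Q : Kernel (E d × E d) ℝ) (_ : IsMarkovKernel Q),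
      IsOutcomeModel 𝒳 τ f Q → ∀ X : Fin n → E d, (∀ i, X i ∈ 𝒳) →
      c * (n * h ^ d) ≤ (near X x (r * h)).card → c * (n * h ^ d) ≤ (near X x' (r * h)).card →
        fixedRisk K h lam x x' f Q X ≤
          ENNReal.ofReal (C * (h ^ (2 * β) + 1 / (n * h ^ d) ^ 2)) := by
  -- `s` bounds the average kernel product from below; `C₁`, `C₂`, `C₃` serve the bias, the variance
  -- and the case `c * (n * h ^ d) < 2`.
  set s : ℝ := κ ^ 2 * c ^ 2 / 2 with hs
  have hs0 : 0 < s := by positivity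
  set C₁ : ℝ := (2 * L * R ^ β + 2 * L / s) ^ 2
  set C₂ : ℝ := 4 * τ * (M ^ 2 + 1) / s
  set C₃ : ℝ := (4 * L ^ 2 + 2 * τ) * (2 / c) ^ 2
  have hC₁ : 0 ≤ C₁ := by positivity
  have hC₂ : 0 ≤ C₂ := by positivity
  have hC₃ : 0 ≤ C₃ := by positivity
  refine ⟨C₁ + C₂ + C₃, by positivity, fun n h lam hn hh hh1 hlam hlamh f hf Q _ hQ X hX hA hB => ?_⟩
  have hn' : (2 : ℝ) ≤ n := by exact_mod_cast hn
  have hT0 : 0 < n * h ^ d := by positivity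
  have hhβ : 0 ≤ h ^ (2 * β) := by positivity
  have hT2 : 0 ≤ 1 / (n * h ^ d) ^ 2 := by positivity
  rcases lt_or_ge (c * (n * h ^ d)) 2 with hT | hT
  · refine (fixedRisk_le_const hn hτ hh hlam hK hx hx' hf hQ hX).trans
      (ENNReal.ofReal_le_ofReal ?_)
    have := const_le_div_sq (a := 4 * L ^ 2 + 2 * τ) (by positivity) hT0
      ((le_div_iff₀' hc).2 hT.le)
    exact this.trans (mul_le_mul (by linarith) (by linarith) hT2 (by positivity))
  set a : Fin n × Fin n → ℝ := fun p =>
    scaledKernel K h (x - X p.1) * scaledKernel K h (x' - X p.2) with ha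
  have ha0 (p) : 0 ≤ a p := mul_nonneg (scaledKernel_nonneg hK hh _) (scaledKernel_nonneg hK hh _)
  have hw (p : Fin n × Fin n) : linkWeight K h lam x x' X p.1 p.2 = a p + lam := rfl
  have hN := card_pairs_pos hn
  have hS : (pairs n).card * s ≤ ∑ p ∈ pairs n, a p :=
    le_sum_scaledKernel_mul hK hκ hr hh hc hA hB hT
  set D := ∑ p ∈ pairs n, linkWeight K h lam x x' X p.1 p.2 with hDdef
  have hDeq : D = (∑ p ∈ pairs n, a p) + (pairs n).card * lam := by
    simp only [hDdef, hw, Finset.sum_add_distrib, Finset.sum_const, nsmul_eq_mul]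
  have hDN : (pairs n).card * s ≤ D := by
    rw [hDeq]
    nlinarith
  have hD : 0 < D := lt_of_lt_of_le (by positivity) hDN
  have hlamβ : lam ≤ h ^ β := by
    refine hlamh.trans ?_
    rw [← Real.rpow_natCast]
    exact Real.rpow_le_rpow_of_exponent_ge hh hh1 (hβ1.trans (by exact_mod_cast hd))
  refine (fixedRisk_le_bias_add_variance hn hf.1 hQ hX hD rfl).trans
    (ENNReal.ofReal_le_ofReal ?_)
  have hbias : ((∑ p ∈ pairs n, |f x x' - f (X p.1) (X p.2)| *
      |linkWeight K h lam x x' X p.1 p.2|) / D) ^ 2 ≤ C₁ * h ^ (2 * β) := by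
    have hpow : h ^ (2 * β) = (h ^ β) ^ 2 := by
      rw [mul_comm, Real.rpow_mul hh.le, Real.rpow_two]
    rw [hpow, ← mul_pow]
    refine pow_le_pow_left₀ (by positivity) ?_ 2
    rw [div_le_iff₀ hD]
    -- Hölder continuity controls the kernel part, supported on nearby pairs; `lam` weights all
    -- pairs, where only boundedness of `f` helps.
    have hterm (p : Fin n × Fin n) : |f x x' - f (X p.1) (X p.2)| *
        |linkWeight K h lam x x' X p.1 p.2| ≤ 2 * L * (R * h) ^ β * a p + 2 * L * lam := by
      rw [hw, abs_of_pos (add_pos_of_nonneg_of_pos (ha0 p) hlam), mul_add]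
      refine add_le_add ?_ (mul_le_mul_of_nonneg_right
        (abs_sub_le_of_mem_holderClass hf hx hx' (hX _) (hX _)) hlam.le)
      by_cases hap : a p = 0
      · simp [hap]
      · exact mul_le_mul_of_nonneg_right (abs_sub_le_rpow_of_mem_holderClass hβ hL hf hx hx'
          (hX _) (hX _) (norm_le_of_scaledKernel_ne_zero hR hh (left_ne_zero_of_mul hap))
          (norm_le_of_scaledKernel_ne_zero hR hh (right_ne_zero_of_mul hap))) (ha0 p)
    refine (Finset.sum_le_sum fun p _ => hterm p).trans ?_
    have h1 : ∑ p ∈ pairs n, a p ≤ D := hDeq ▸ le_add_of_nonneg_right (by positivity)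
    have h2 : ((pairs n).card : ℝ) ≤ D / s := (le_div_iff₀ hs0).2 hDN
    have h3 : 2 * L * (R * h) ^ β * ∑ p ∈ pairs n, a p ≤ 2 * L * (R * h) ^ β * D :=
      mul_le_mul_of_nonneg_left h1 (by positivity)
    have h4 : (pairs n).card * (2 * L * lam) ≤ D / s * (2 * L * h ^ β) :=
      mul_le_mul h2 (mul_le_mul_of_nonneg_left hlamβ (by positivity)) (by positivity)
        (by positivity)
    rw [Finset.sum_add_distrib, ← Finset.mul_sum, Finset.sum_const, nsmul_eq_mul]
    refine (add_le_add h3 h4).trans (le_of_eq ?_)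
    rw [Real.mul_rpow hR0.le hh.le]
    ring
  have hvar : 2 * τ * (∑ p ∈ pairs n, linkWeight K h lam x x' X p.1 p.2 ^ 2) / D ^ 2 ≤
      C₂ * (1 / (n * h ^ d) ^ 2) := by
    have hDn : n ^ 2 / 2 * s ≤ D := by
      refine le_trans ?_ hDN
      gcongr
      rw [card_pairs]
      nlinarith
    have hratio := sum_sq_div_sq_sum_le (s := pairs n)
      (w := fun p => linkWeight K h lam x x' X p.1 p.2) (W := (M ^ 2 + 1) / (h ^ d) ^ 2)
      (fun p => by rw [hw]; exact (add_pos_of_nonneg_of_pos (ha0 p) hlam).le)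
      (fun p => linkWeight_le hK hM hh hh1 hlamh x x' X p.1 p.2) rfl (by positivity) hDn
      (by positivity)
    rw [mul_div_assoc]
    refine (mul_le_mul_of_nonneg_left hratio (by positivity)).trans (le_of_eq ?_)
    simp only [C₂]
    field_simp
    ring
  exact (add_le_add hbias hvar).trans (mul_add_mul_le_add_mul_add hC₁ hC₂ hC₃ hhβ hT2)

lemma IsAdmissible.h_pos {d n : ℕ} {ν h lam : ℝ} (hn : 2 ≤ n) (ha : IsAdmissible d n ν h lam) :
    0 < h :=
  (Real.rpow_pos_of_pos (by positivity) _).trans_le ha.le_h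

lemma IsAdmissible.lam_pos {d n : ℕ} {ν h lam : ℝ} (hn : 2 ≤ n) (ha : IsAdmissible d n ν h lam) :
    0 < lam := by
  have := ha.h_pos hn
  exact lt_of_lt_of_le (by positivity) ha.le_lam

/-! ### Fixed design: counting covariates by volume -/

section FixedDesign

lemma rpow_one_div_natCast_pow {d : ℕ} (hd : 1 ≤ d) (n : ℕ) :
    ((n : ℝ) ^ ((1 : ℝ) / d)) ^ d = n := by
  rw [one_div, Real.rpow_inv_natCast_pow (Nat.cast_nonneg n) (by omega)]

/-- Balls of radius `δ` around the covariates cover `𝒳`. Those needed to cover the part within `ρ`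
of `x` have centers within `ρ + δ ≤ 2 * ρ`, so comparing volumes bounds their number from below. -/
lemma IsFixedDesign.mul_le_card_near {d n : ℕ} (hd : 1 ≤ d) (hn : 2 ≤ n) {𝒳 : Set (E d)}
    {c_X C_X : ℝ} (hC : 0 < C_X) {X : Fin n → E d} (hX : IsFixedDesign 𝒳 c_X C_X X) {x : E d}
    {c ρ : ℝ} (hc : ENNReal.ofReal (c * ρ ^ d) ≤ volume (𝒳 ∩ Metric.closedBall x ρ))
    (hδ : C_X / (n : ℝ) ^ ((1 : ℝ) / d) ≤ ρ) :
    c * ρ ^ d * n ≤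
      (near X x (2 * ρ)).card * (volume.real (Metric.ball (0 : E d) 1) * C_X ^ d) := by
  set δ := C_X / (n : ℝ) ^ ((1 : ℝ) / d) with hδdef
  have hδ0 : 0 < δ := by positivity
  have hn0 : (0 : ℝ) < n := by positivity
  have hcover : 𝒳 ∩ Metric.closedBall x ρ ⊆ ⋃ j ∈ near X x (2 * ρ), Metric.closedBall (X j) δ := by
    rintro z ⟨hz, hzx⟩
    obtain ⟨j, hj⟩ := hX.covering z hz
    simp only [Set.mem_iUnion, mem_near, Metric.mem_closedBall, dist_eq_norm, exists_prop] at hzx ⊢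
    refine ⟨j, ?_, hj⟩
    have := norm_sub_le_norm_sub_add_norm_sub x z (X j)
    rw [norm_sub_rev x z] at this
    linarith
  have hvol : volume (𝒳 ∩ Metric.closedBall x ρ) ≤
      ENNReal.ofReal ((near X x (2 * ρ)).card * (δ ^ d * volume.real (Metric.ball (0 : E d) 1))) := by
    refine (measure_mono hcover).trans ((measure_biUnion_finset_le _ _).trans (le_of_eq ?_))
    have hball : ∀ j, volume (Metric.closedBall (X j) δ) =
        ENNReal.ofReal (δ ^ d * volume.real (Metric.ball (0 : E d) 1)) := fun j => by
      rw [Measure.addHaar_closedBall _ _ hδ0.le, ENNReal.ofReal_mul (by positivity),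
        ofReal_measureReal measure_ball_lt_top.ne, finrank_euclideanSpace_fin]
    simp only [hball, Finset.sum_const, nsmul_eq_mul]
    rw [ENNReal.ofReal_mul (Nat.cast_nonneg _), ENNReal.ofReal_natCast]
  have hle := (ENNReal.ofReal_le_ofReal_iff (by positivity)).1 (hc.trans hvol)
  have hδn : δ ^ d * n = C_X ^ d := by
    rw [hδdef, div_pow, rpow_one_div_natCast_pow hd, div_mul_cancel₀ _ hn0.ne']
  calc c * ρ ^ d * n ≤ (near X x (2 * ρ)).card *
        (δ ^ d * volume.real (Metric.ball (0 : E d) 1)) * n := by gcongr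
    _ = (near X x (2 * ρ)).card * (volume.real (Metric.ball (0 : E d) 1) * (δ ^ d * n)) := by ring
    _ = _ := by rw [hδn]

/-- In fixed design, the number of covariates within `r * h` of a regular point is of order
`n * h ^ d`, unless the bandwidth is of the order of the spacing of the covariates. -/
lemma exists_mul_le_card_near {d : ℕ} (hd : 1 ≤ d) {𝒳 : Set (E d)} {x : E d}
    (hx : VolumeRegularAt 𝒳 x) {c_X C_X : ℝ} (hC : 0 < C_X) {r : ℝ} (hr : 0 < r) (hr1 : r ≤ 1) :
    ∃ c : ℝ, 0 < c ∧ ∀ (n : ℕ) (h : ℝ), 2 ≤ n → 0 < h → h ≤ 1 →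
      C_X / (n : ℝ) ^ ((1 : ℝ) / d) ≤ r * h / 2 → ∀ X : Fin n → E d, IsFixedDesign 𝒳 c_X C_X X →
        c * (n * h ^ d) ≤ (near X x (r * h)).card := by
  obtain ⟨c, hc, hreg⟩ := hx
  set V := volume.real (Metric.ball (0 : E d) 1)
  have hV : 0 < V := ENNReal.toReal_pos (Metric.measure_ball_pos volume _ one_pos).ne'
    measure_ball_lt_top.ne
  refine ⟨c * (r / 2) ^ d / (V * C_X ^ d), by positivity, fun n h hn hh hh1 hδ X hX => ?_⟩
  have hρ1 : r * h / 2 ≤ 1 := by nlinarith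
  have := hX.mul_le_card_near hd hn hC (x := x) (c := c) (ρ := r * h / 2)
    (hreg _ (by positivity) hρ1) hδ
  rw [mul_div_cancel₀ _ (two_ne_zero' ℝ)] at this
  rw [div_mul_eq_mul_div, div_le_iff₀ (by positivity)]
  refine le_trans (le_of_eq ?_) this
  rw [show r * h / 2 = r / 2 * h by ring, mul_pow]
  ring

lemma exists_worstFixedRisk_le {d : ℕ} (hd : 1 ≤ d) {𝒳 : Set (E d)} {x x' : E d} (hx : x ∈ 𝒳)
    (hx' : x' ∈ 𝒳) (hxreg : VolumeRegularAt 𝒳 x) (hxreg' : VolumeRegularAt 𝒳 x')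
    {β L τ ν : ℝ} (hβ : 0 < β) (hβ1 : β ≤ 1) (hL : 0 < L) (hτ : 0 < τ)
    {K : E d → ℝ} (hK : IsSmoothingKernel K) {c_X C_X : ℝ} (hC : 0 < C_X) :
    ∃ C : ℝ, 0 < C ∧ ∀ (n : ℕ) (h lam : ℝ), 2 ≤ n → IsAdmissible d n ν h lam →
      ∀ X : Fin n → E d, IsFixedDesign 𝒳 c_X C_X X →
        worstFixedRisk 𝒳 β L τ K h lam x x' X ≤
          ENNReal.ofReal (C * (h ^ (2 * β) + 1 / ((n : ℝ) * h ^ d) ^ 2)) := by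
  obtain ⟨M, R, r, κ, hR0, hr0, hr1, hκ, hM, hR, hr⟩ := hK.exists_bounds
  obtain ⟨c, hc, hA⟩ := exists_mul_le_card_near hd hxreg (c_X := c_X) hC hr0 hr1
  obtain ⟨c', hc', hB⟩ := exists_mul_le_card_near hd hxreg' (c_X := c_X) hC hr0 hr1
  obtain ⟨C, hC0, hrisk⟩ := exists_fixedRisk_le_of_near hd hx hx' hβ.le hβ1 hL.le hτ.le hK.nonneg
    hR0 hκ hM hR hr (lt_min hc hc')
  -- The second summand covers bandwidths comparable to the spacing, where `n * h ^ d ≤ (2 * C_X /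
  -- r) ^ d` and the constant risk bound suffices.
  refine ⟨C + (4 * L ^ 2 + 2 * τ) * ((2 * C_X / r) ^ d) ^ 2, by positivity,
    fun n h lam hn ha X hX => ?_⟩
  have hh := ha.h_pos hn
  have hn0 : (0 : ℝ) < n := by positivity
  have hT0 : 0 < n * h ^ d := by positivity
  have hH : 0 ≤ h ^ (2 * β) := by positivity
  have hV : 0 ≤ 1 / (n * h ^ d) ^ 2 := by positivity
  have hC' : 0 ≤ (4 * L ^ 2 + 2 * τ) * ((2 * C_X / r) ^ d) ^ 2 := by positivity
  refine iSup_le fun f => iSup_le fun hf => iSup_le fun Q => iSup_le fun hQ => iSup_le fun hfQ => ?_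
  rcases le_or_gt (C_X / (n : ℝ) ^ ((1 : ℝ) / d)) (r * h / 2) with hδ | hδ
  · refine (hrisk n h lam hn hh ha.h_le (ha.lam_pos hn) ha.lam_le f hf Q hQ hfQ X hX.mem
      (le_trans ?_ (hA n h hn hh ha.h_le hδ X hX))
      (le_trans ?_ (hB n h hn hh ha.h_le hδ X hX))).trans (ENNReal.ofReal_le_ofReal ?_)
    · exact mul_le_mul_of_nonneg_right (min_le_left _ _) hT0.le
    · exact mul_le_mul_of_nonneg_right (min_le_right _ _) hT0.le
    · exact mul_le_mul_of_nonneg_right (by linarith) (by linarith)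
  · have hT : n * h ^ d ≤ (2 * C_X / r) ^ d := by
      rw [← rpow_one_div_natCast_pow hd n, ← mul_pow]
      refine pow_le_pow_left₀ (by positivity) ?_ d
      rw [le_div_iff₀ hr0]
      rw [lt_div_iff₀ (by positivity)] at hδ
      linarith
    refine (fixedRisk_le_const hn hτ.le hh (ha.lam_pos hn) hK.nonneg hx hx' hf hfQ hX.mem).trans
      (ENNReal.ofReal_le_ofReal ((const_le_div_sq (by positivity) hT0 hT).trans ?_))
    exact mul_le_mul (by linarith) (by linarith) hV (by linarith)

end FixedDesign

/-! ### Random design: binomial concentration -/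

section RandomDesign

/-- The Laplace transform at `-1` of the binomial number of covariates in a ball. -/
lemma lintegral_exp_neg_card_near_le {d : ℕ} (μ : Measure (E d)) [IsProbabilityMeasure μ] (n : ℕ)
    (x : E d) (ρ : ℝ) {q : ℝ} (hq : q ≤ μ.real (Metric.closedBall x ρ)) :
    ∫⁻ X, ENNReal.ofReal (Real.exp (-(near X x ρ).card)) ∂(Measure.pi fun _ : Fin n => μ) ≤
      ENNReal.ofReal (Real.exp (-(n * q / 2))) := by
  set B := Metric.closedBall x ρ
  have hB : MeasurableSet B := Metric.isClosed_closedBall.measurableSet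
  -- `g` is `exp (-1)` on the ball and 1 off it, so the exponential of minus the count is a product
  -- over independent covariates.
  set g : E d → ℝ := fun z => 1 - (1 - Real.exp (-1)) * B.indicator 1 z with hg
  have hgX (X : Fin n → E d) : Real.exp (-(near X x ρ).card) = ∏ i, g (X i) := by
    have hcard : ((near X x ρ).card : ℝ) = ∑ i, B.indicator (1 : E d → ℝ) (X i) := by
      simp only [near, Finset.card_filter, Nat.cast_sum]
      refine Finset.sum_congr rfl fun i _ => ?_
      rw [norm_sub_rev]
      by_cases hi : ‖X i - x‖ ≤ ρ <;>
        simp [B, Set.indicator, Metric.mem_closedBall, dist_eq_norm, hi]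
    rw [hcard, ← Finset.sum_neg_distrib, Real.exp_sum]
    refine Finset.prod_congr rfl fun i _ => ?_
    by_cases hi : X i ∈ B <;> simp [hg, hi]
  have hint : Integrable (B.indicator (1 : E d → ℝ)) μ :=
    (integrable_const (1 : ℝ)).indicator hB
  have hgint : Integrable g μ := (integrable_const _).sub (hint.const_mul _)
  have hg0 (z : E d) : 0 ≤ g z := by
    by_cases hz : z ∈ B <;> simp [hg, hz, Real.exp_nonneg]
  -- With `p` the mass of the ball, `1 - (1 - exp (-1)) * p ≤ 1 - q / 2 ≤ exp (-(q / 2))`.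
  have hgmean : ∫ z, g z ∂μ ≤ Real.exp (-(q / 2)) := by
    rw [hg, integral_sub (integrable_const _) (hint.const_mul _), integral_const_mul,
      integral_indicator_one hB]
    simp only [integral_const, probReal_univ, smul_eq_mul, mul_one]
    have he : Real.exp (-1) ≤ 1 / 2 := by
      have := Real.add_one_le_exp 1
      rw [Real.exp_neg, ← one_div]
      exact one_div_le_one_div_of_le (by norm_num) (by linarith)
    have hp : 0 ≤ μ.real B := measureReal_nonneg
    have := Real.one_sub_le_exp_neg (q / 2)
    nlinarith
  simp only [hgX]
  rw [← ofReal_integral_eq_lintegral_ofReal (Integrable.fintype_prod fun _ => hgint)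
    (ae_of_all _ fun X => Finset.prod_nonneg fun i _ => hg0 _)]
  refine ENNReal.ofReal_le_ofReal ?_
  rw [integral_fintype_prod_eq_pow, Fintype.card_fin]
  refine (pow_le_pow_left₀ (integral_nonneg hg0) hgmean n).trans (le_of_eq ?_)
  rw [← Real.exp_nat_mul]
  congr 1
  ring

lemma IsDesignDensity.exists_mul_le_measure_closedBall {d : ℕ} {𝒳 : Set (E d)}
    {m : E d → ℝ} (hm : IsDesignDensity 𝒳 m) (h𝒳 : MeasurableSet 𝒳) {x : E d}
    (hx : VolumeRegularAt 𝒳 x) :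
    ∃ c : ℝ, 0 < c ∧ ∀ ρ : ℝ, 0 < ρ → ρ ≤ 1 →
      c * ρ ^ d ≤ (covariateLaw 𝒳 m).real (Metric.closedBall x ρ) := by
  obtain ⟨l, u, hl, hlu⟩ := hm.bounds
  obtain ⟨c, hc, hreg⟩ := hx
  have := hm.isProbability
  refine ⟨l * c, by positivity, fun ρ hρ hρ1 => ?_⟩
  have hB : MeasurableSet (Metric.closedBall x ρ) := Metric.isClosed_closedBall.measurableSet
  rw [measureReal_def, ← ENNReal.ofReal_le_iff_le_toReal (measure_ne_top _ _), covariateLaw,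
    withDensity_apply _ hB, Measure.restrict_restrict hB, mul_assoc, ENNReal.ofReal_mul hl.le]
  calc ENNReal.ofReal l * ENNReal.ofReal (c * ρ ^ d)
      ≤ ENNReal.ofReal l * volume (𝒳 ∩ Metric.closedBall x ρ) := by
        gcongr
        exact hreg ρ hρ hρ1
    _ = ∫⁻ _ in Metric.closedBall x ρ ∩ 𝒳, ENNReal.ofReal l := by
        rw [setLIntegral_const, Set.inter_comm]
    _ ≤ ∫⁻ z in Metric.closedBall x ρ ∩ 𝒳, ENNReal.ofReal (m z) := by
        refine setLIntegral_mono_ae' (hB.inter h𝒳) (ae_of_all _ fun z hz => ?_)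
        exact ENNReal.ofReal_le_ofReal (hlu z hz.2).1

lemma ae_mem_of_covariateLaw {d : ℕ} {𝒳 : Set (E d)} (h𝒳 : MeasurableSet 𝒳) (m : E d → ℝ) :
    ∀ᵐ z ∂(covariateLaw 𝒳 m), z ∈ 𝒳 :=
  (withDensity_absolutelyContinuous _ _).ae_le (ae_restrict_mem h𝒳)

lemma measurable_smoother {d n : ℕ} {K : E d → ℝ} (hK : Measurable K) (h lam : ℝ) (x x' : E d) :
    Measurable fun XY : (Fin n → E d) × (Link n → ℝ) => smoother K h lam x x' XY.1 XY.2 := by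
  have hY (i j : Fin n) :
      Measurable fun XY : (Fin n → E d) × (Link n → ℝ) => symOutcome XY.2 i j := by
    unfold symOutcome
    split_ifs <;> fun_prop
  have hS (y : E d) (i : Fin n) :
      Measurable fun XY : (Fin n → E d) × (Link n → ℝ) => scaledKernel K h (y - XY.1 i) := by
    unfold scaledKernel
    fun_prop
  unfold smoother
  fun_prop

lemma randomRisk_eq_lintegral_fixedRisk {d n : ℕ} {K : E d → ℝ} (hK : Measurable K) (h lam : ℝ)
    (x x' : E d) (f : E d → E d → ℝ) (Q : Kernel (E d × E d) ℝ) [IsMarkovKernel Q]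
    (μ : Measure (E d)) [IsProbabilityMeasure μ] :
    randomRisk n K h lam x x' f Q μ =
      ∫⁻ X, fixedRisk K h lam x x' f Q X ∂(Measure.pi fun _ : Fin n => μ) := by
  have := measurable_smoother (n := n) hK h lam x x'
  rw [randomRisk, Measure.lintegral_compProd (by fun_prop)]
  rfl

lemma exp_neg_le_two_div_sq {t : ℝ} (ht : 0 < t) : Real.exp (-t) ≤ 2 / t ^ 2 := by
  have := Real.quadratic_le_exp_of_nonneg ht.le
  rw [Real.exp_neg, ← one_div, div_le_div_iff₀ (Real.exp_pos t) (by positivity)]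
  linarith

/-- Exponential Markov inequality for the event of having too few covariates near `x`. -/
lemma lintegral_exp_sub_card_near_le {d n : ℕ} (μ : Measure (E d)) [IsProbabilityMeasure μ]
    (x : E d) {ρ c v : ℝ} (hc : 0 < c) (hv : 0 < n * v)
    (hq : 4 * c * v ≤ μ.real (Metric.closedBall x ρ)) :
    ∫⁻ X, ENNReal.ofReal (Real.exp (c * (n * v) - (near X x ρ).card))
        ∂(Measure.pi fun _ : Fin n => μ) ≤
      ENNReal.ofReal (2 / c ^ 2 * (1 / (n * v) ^ 2)) := by
  simp only [sub_eq_add_neg, Real.exp_add, ENNReal.ofReal_mul (Real.exp_nonneg _)]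
  rw [lintegral_const_mul' _ _ ENNReal.ofReal_ne_top]
  refine (mul_le_mul_right (lintegral_exp_neg_card_near_le μ n x ρ hq) _).trans ?_
  -- The factor 4 in `hq` makes the Laplace exponent twice the threshold `c * (n * v)`, leaving a
  -- decaying exponential.
  rw [← ENNReal.ofReal_mul (Real.exp_nonneg _), ← Real.exp_add,
    show c * (n * v) + -(n * (4 * c * v) / 2) = -(c * (n * v)) by ring]
  refine ENNReal.ofReal_le_ofReal ((exp_neg_le_two_div_sq (by positivity)).trans (le_of_eq ?_))
  rw [mul_pow]
  field_simp

lemma exists_worstRandomRisk_le {d : ℕ} (hd : 1 ≤ d) {𝒳 : Set (E d)} (h𝒳 : MeasurableSet 𝒳)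
    {x x' : E d} (hx : x ∈ 𝒳) (hx' : x' ∈ 𝒳) (hxreg : VolumeRegularAt 𝒳 x)
    (hxreg' : VolumeRegularAt 𝒳 x') {β L τ ν : ℝ} (hβ : 0 < β) (hβ1 : β ≤ 1) (hL : 0 < L)
    (hτ : 0 < τ) {K : E d → ℝ} (hK : IsSmoothingKernel K) {m : E d → ℝ}
    (hm : IsDesignDensity 𝒳 m) :
    ∃ C : ℝ, 0 < C ∧ ∀ (n : ℕ) (h lam : ℝ), 2 ≤ n → IsAdmissible d n ν h lam →
      worstRandomRisk 𝒳 β L τ n K h lam x x' m ≤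
        ENNReal.ofReal (C * (h ^ (2 * β) + 1 / ((n : ℝ) * h ^ d) ^ 2)) := by
  have := hm.isProbability
  obtain ⟨M, R, r, κ, hR0, hr0, hr1, hκ, hM, hR, hr⟩ := hK.exists_bounds
  obtain ⟨a, ha0, ha⟩ := hm.exists_mul_le_measure_closedBall h𝒳 hxreg
  obtain ⟨b, hb0, hb⟩ := hm.exists_mul_le_measure_closedBall h𝒳 hxreg'
  set c : ℝ := min a b * r ^ d / 4 with hcdef
  have hab : 0 < min a b := lt_min ha0 hb0
  have hc : 0 < c := by positivity
  obtain ⟨C, hC0, hrisk⟩ := exists_fixedRisk_le_of_near hd hx hx' hβ.le hβ1 hL.le hτ.le hK.nonneg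
    hR0 hκ hM hR hr hc
  set C' : ℝ := 4 * L ^ 2 + 2 * τ with hC'def
  have hC' : 0 < C' := by positivity
  refine ⟨C + C' * (2 / c ^ 2 + 2 / c ^ 2), by positivity, fun n h lam hn hadm => ?_⟩
  have hh := hadm.h_pos hn
  have hh1 := hadm.h_le
  have hn0 : (0 : ℝ) < n := by positivity
  have hT0 : 0 < n * h ^ d := by positivity
  have hH : 0 ≤ h ^ (2 * β) := by positivity
  have hV : 0 ≤ 1 / (n * h ^ d) ^ 2 := by positivity
  have hrh : 0 < r * h := by positivity
  have hrh1 : r * h ≤ 1 := mul_le_one₀ hr1 hh.le hh1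
  have hball : 4 * c * h ^ d = min a b * (r * h) ^ d := by
    rw [hcdef, mul_pow]
    ring
  have hA := lintegral_exp_sub_card_near_le (n := n) (covariateLaw 𝒳 m) x hc hT0 (ρ := r * h)
    (hball ▸ (mul_le_mul_of_nonneg_right (min_le_left _ _) (by positivity)).trans (ha _ hrh hrh1))
  have hB := lintegral_exp_sub_card_near_le (n := n) (covariateLaw 𝒳 m) x' hc hT0 (ρ := r * h)
    (hball ▸ (mul_le_mul_of_nonneg_right (min_le_right _ _) (by positivity)).trans (hb _ hrh hrh1))
  refine iSup_le fun f => iSup_le fun hf => iSup_le fun Q => iSup_le fun hQ => iSup_le fun hfQ => ?_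
  rw [randomRisk_eq_lintegral_fixedRisk hK.measurable]
  set G : ℝ := C * (h ^ (2 * β) + 1 / (n * h ^ d) ^ 2)
  set eA : (Fin n → E d) → ENNReal := fun X =>
    ENNReal.ofReal (Real.exp (c * (n * h ^ d) - (near X x (r * h)).card))
  set eB : (Fin n → E d) → ENNReal := fun X =>
    ENNReal.ofReal (Real.exp (c * (n * h ^ d) - (near X x' (r * h)).card))
  -- `eA` and `eB` dominate the indicators of a shortage near `x` and near `x'`, so the constant
  -- risk bound is charged only to those events.
  have hpoint : ∀ᵐ X ∂(Measure.pi fun _ : Fin n => covariateLaw 𝒳 m),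
      fixedRisk K h lam x x' f Q X ≤
        ENNReal.ofReal G + ENNReal.ofReal C' * (eA X + eB X) := by
    have hmem : ∀ᵐ X ∂(Measure.pi fun _ : Fin n => covariateLaw 𝒳 m), ∀ i, X i ∈ 𝒳 :=
      Filter.eventually_all.2 fun i =>
        Measure.tendsto_eval_ae_ae.eventually (ae_mem_of_covariateLaw h𝒳 m)
    filter_upwards [hmem] with X hX
    have hconst := fixedRisk_le_const hn hτ.le hh (hadm.lam_pos hn) hK.nonneg hx hx' hf hfQ hX
    have hexp {t : ℝ} (ht : 0 ≤ t) : 1 ≤ ENNReal.ofReal (Real.exp t) := by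
      rw [← ENNReal.ofReal_one]
      exact ENNReal.ofReal_le_ofReal (Real.one_le_exp ht)
    by_cases hAX : c * (n * h ^ d) ≤ (near X x (r * h)).card
    · by_cases hBX : c * (n * h ^ d) ≤ (near X x' (r * h)).card
      · exact (hrisk n h lam hn hh hh1 (hadm.lam_pos hn) hadm.lam_le f hf Q hQ hfQ X hX hAX
          hBX).trans le_self_add
      · refine hconst.trans (le_trans ?_ le_add_self)
        exact le_mul_of_one_le_right' ((hexp (sub_nonneg.2 (not_le.1 hBX).le)).trans le_add_self)
    · refine hconst.trans (le_trans ?_ le_add_self)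
      exact le_mul_of_one_le_right' ((hexp (sub_nonneg.2 (not_le.1 hAX).le)).trans le_self_add)
  have hmeas (y : E d) : Measurable fun X : Fin n → E d =>
      ENNReal.ofReal (Real.exp (c * (n * h ^ d) - (near X y (r * h)).card)) := by
    simp only [near, Finset.card_filter, Nat.cast_sum, Nat.cast_ite]
    refine ENNReal.measurable_ofReal.comp (Real.measurable_exp.comp (measurable_const.sub
      (Finset.measurable_sum _ fun i _ => Measurable.ite ?_ measurable_const measurable_const)))
    exact measurableSet_le (by fun_prop) measurable_const
  refine (lintegral_mono_ae hpoint).trans ?_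
  rw [lintegral_add_left measurable_const, lintegral_const_mul' _ _ ENNReal.ofReal_ne_top,
    lintegral_add_left (hmeas x)]
  simp only [lintegral_const, measure_univ, mul_one]
  refine (add_le_add_right (mul_le_mul_right (add_le_add hA hB) _) _).trans ?_
  rw [← ENNReal.ofReal_add (by positivity) (by positivity), ← ENNReal.ofReal_mul hC'.le,
    ← ENNReal.ofReal_add (by positivity) (by positivity)]
  refine ENNReal.ofReal_le_ofReal ?_
  have h0 : 0 ≤ C' * (2 / c ^ 2 + 2 / c ^ 2) * h ^ (2 * β) := by positivity
  simp only [G]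
  linarith

end RandomDesign

end LinkRegression

theorem theorem2 (d : ℕ) (hd : 1 ≤ d) (𝒳 : Set (LinkRegression.E d)) (h𝒳 : IsCompact 𝒳)
    (x x' : LinkRegression.E d) (hx : x ∈ 𝒳) (hx' : x' ∈ 𝒳)
    (hxreg : LinkRegression.VolumeRegularAt 𝒳 x) (hxreg' : LinkRegression.VolumeRegularAt 𝒳 x')
    (β L τ ν : ℝ) (hβ : 0 < β) (hβ1 : β ≤ 1) (hL : 0 < L) (hτ : 0 < τ) (hν : 0 < ν)
    (K : LinkRegression.E d → ℝ) (hK : LinkRegression.IsSmoothingKernel K) :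
    (∀ c_X C_X : ℝ, 0 < c_X → 0 < C_X →
      ∃ C : ℝ, 0 < C ∧ ∀ (n : ℕ) (h lam : ℝ), 2 ≤ n → LinkRegression.IsAdmissible d n ν h lam →
        ∀ X : Fin n → LinkRegression.E d, LinkRegression.IsFixedDesign 𝒳 c_X C_X X →
          LinkRegression.worstFixedRisk 𝒳 β L τ K h lam x x' X ≤
            ENNReal.ofReal (C * (h ^ (2 * β) + 1 / ((n : ℝ) * h ^ d) ^ 2))) ∧
    (∀ m : LinkRegression.E d → ℝ, LinkRegression.IsDesignDensity 𝒳 m →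
      ∃ C : ℝ, 0 < C ∧ ∀ (n : ℕ) (h lam : ℝ), 2 ≤ n → LinkRegression.IsAdmissible d n ν h lam →
        LinkRegression.worstRandomRisk 𝒳 β L τ n K h lam x x' m ≤
          ENNReal.ofReal (C * (h ^ (2 * β) + h ^ (2 * β) * (1 / ((n : ℝ) * h ^ d)) +
            1 / ((n : ℝ) * h ^ d) ^ 2))) := by
  refine ⟨fun c_X C_X _ hC => LinkRegression.exists_worstFixedRisk_le hd hx hx' hxreg hxreg' hβ hβ1
    hL hτ hK hC, fun m hm => ?_⟩
  obtain ⟨C, hC, hrisk⟩ := LinkRegression.exists_worstRandomRisk_le (ν := ν) hd h𝒳.measurableSet hx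
    hx' hxreg hxreg' hβ hβ1 hL hτ hK hm
  refine ⟨C, hC, fun n h lam hn ha =>
    (hrisk n h lam hn ha).trans (ENNReal.ofReal_le_ofReal ?_)⟩
  have hh := ha.h_pos hn
  -- The two-term bound is already stronger; the mixed term only enlarges the right side.
  have h0 : 0 ≤ h ^ (2 * β) * (1 / ((n : ℝ) * h ^ d)) := by positivity
  exact mul_le_mul_of_nonneg_left (by linarith) hC.le
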